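/- Let $0<\mu<\lambda$, and let $U_1,D_1,U_2,D_2,\ldots$ be mutually independent random variables, where every $U_i$ is exponentially distributed with rate $\lambda$ and every $D_i$ is exponentially distributed with rate $\mu$. For $t\ge 0$ put $$N(t)=\max\Big\{n\in\mathbb N_0:\ \sum_{i=1}^n U_i\le t\Big\},\qquad Y(t)=\sum_{n=1}^{N(t)}D_n,$$ and for $x>0$ let $$T_x=\inf\{t>0:\ Y(t)\ge x+t\}\in[0,\infty],\qquad \inf\emptyset=\infty.$$ Then, for every $x>0$ and every real $s<(\sqrt\lambda-\sqrt\mu)^2$, the random time $T_x$ is almost surely finite, $\mathrm e^{sT_x}$ is integrable, and the moment generating function of $T_x$ at $s$ is $$M_{T_x}(s):=\mathbb E\big(\mathrm e^{sT_x}\big)=\frac{\lambda+\mu-s-\sqrt{(\lambda+\mu-s)^2-4\lambda\mu}}{2\mu}\;\exp\Big\{\frac x2\Big[\lambda-\mu-s-\sqrt{(\lambda+\mu-s)^2-4\lambda\mu}\Big]\Big\}.$$ -/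

import Mathlib

open MeasureTheory ProbabilityTheory

noncomputable section

namespace AlternatingMotion

variable {Ω : Type*}

/-- `N(t) = max {n ∈ ℕ₀ : U₁ + ⋯ + Uₙ ≤ t}`, the counting process of the upward periods.
The sequences are indexed from `0`, so `U i` stands for the `(i+1)`-st upward period. For
exponentially distributed independent periods the set is almost surely finite and nonempty for
every `t ≥ 0`, so that the supremum is its maximum. -/
def countN (U : ℕ → Ω → ℝ) (t : ℝ) (ω : Ω) : ℕ :=
  sSup {n : ℕ | ∑ i ∈ Finset.range n, U i ω ≤ t}

/-- The compound process `Y(t) = D₁ + ⋯ + D_{N(t)}`; `D i` stands for the `(i+1)`-st downward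
period. -/
def procY (U D : ℕ → Ω → ℝ) (t : ℝ) (ω : Ω) : ℝ :=
  ∑ i ∈ Finset.range (countN U t ω), D i ω

/-- The first-passage time `T_x = inf {t > 0 : Y(t) ≥ x + t}`, with values in `[0, ∞]`;
the infimum of the empty set is `∞`. -/
def passageT (U D : ℕ → Ω → ℝ) (x : ℝ) (ω : Ω) : ENNReal :=
  sInf (ENNReal.ofReal '' {t : ℝ | 0 < t ∧ x + t ≤ procY U D t ω})

end AlternatingMotion

end

namespace AlternatingMotion

/-! The barrier $x+t$ rises while $Y$ is constant between jumps, so $T_x=U_1+\dots+U_\tau$, where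
$\tau$ is the first index at which the walk $\sum(D_i-U_i)$ reaches $x$ (`passageT_of_mem_hit`).
Choose $a+b=s$ with $E\,e^{aU+bD}=1$, so that $e^{a\sum U+b\sum D}$ is a martingale; a drift
estimate on the paths still below $x$ justifies stopping it at $\tau$ (`tsum_setLIntegral_hit`). At
$\tau$ the exponent is $sT_x+bx+b\cdot{}$overshoot, and by lack of memory the overshoot contributes
the independent factor $\mu/(\mu-b)$ (`setLIntegral_hit`). Hence
$1=\frac{\mu}{\mu-b}e^{bx}E(e^{sT_x};\tau<\infty)$. The case $s=0$ gives $\tau<\infty$ almost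
surely. Integrals are taken in $[0,\infty]$, so integrability comes out at the end. -/

/-- The partial sums `V 0 + ⋯ + V (n - 1)`. -/
def psum {Ω : Type*} (V : ℕ → Ω → ℝ) (n : ℕ) (ω : Ω) : ℝ :=
  ∑ i ∈ Finset.range n, V i ω

/-- The exponential function with values in `[0, ∞]`. -/
noncomputable def expE (a : ℝ) : ENNReal := ENNReal.ofReal (Real.exp a)

/-- The event that the random walk with steps `D i - U i` stays below `x` up to time `n`. -/
def alive {Ω : Type*} (U D : ℕ → Ω → ℝ) (x : ℝ) (n : ℕ) : Set Ω :=
  {ω | ∀ k ≤ n, psum D k ω - psum U k ω < x}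

/-- The event that the random walk with steps `D i - U i` reaches `x` first at time `n + 1`. -/
def hit {Ω : Type*} (U D : ℕ → Ω → ℝ) (x : ℝ) (n : ℕ) : Set Ω :=
  {ω | ω ∈ alive U D x n ∧ x ≤ psum D (n + 1) ω - psum U (n + 1) ω}

/-! ### Reduction of the passage time to a random walk, path by path. -/

section Paths

variable {Ω : Type*} {U D : ℕ → Ω → ℝ} {x : ℝ} {ω : Ω}

lemma psum_zero (V : ℕ → Ω → ℝ) (ω : Ω) : psum V 0 ω = 0 := by simp [psum]

lemma psum_succ (V : ℕ → Ω → ℝ) (n : ℕ) (ω : Ω) : psum V (n + 1) ω = psum V n ω + V n ω :=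
  Finset.sum_range_succ _ _

lemma strictMono_psum (hpos : ∀ i, 0 < U i ω) : StrictMono fun n => psum U n ω :=
  strictMono_nat_of_lt_succ fun n => by
    rw [psum_succ]
    linarith [hpos n]

/-- Positivity and unboundedness make the `sSup` a true maximum instead of the default value 0. -/
lemma countN_spec (hpos : ∀ i, 0 < U i ω) (hunb : ∀ t, ∃ n, t < psum U n ω) {t : ℝ}
    (ht : 0 ≤ t) : psum U (countN U t ω) ω ≤ t ∧ t < psum U (countN U t ω + 1) ω := by
  obtain ⟨m, hm⟩ := hunb t
  have hbdd : BddAbove {n : ℕ | ∑ i ∈ Finset.range n, U i ω ≤ t} :=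
    ⟨m, fun n hn => (strictMono_psum hpos).le_iff_le.1 (le_trans hn hm.le)⟩
  have hne : {n : ℕ | ∑ i ∈ Finset.range n, U i ω ≤ t}.Nonempty := ⟨0, by simpa using ht⟩
  refine ⟨Nat.sSup_mem hne hbdd, ?_⟩
  by_contra! h
  have := le_csSup hbdd (show countN U t ω + 1 ∈ {n : ℕ | ∑ i ∈ Finset.range n, U i ω ≤ t} from h)
  change countN U t ω + 1 ≤ countN U t ω at this
  omega

lemma countN_psum (hpos : ∀ i, 0 < U i ω) (hunb : ∀ t, ∃ n, t < psum U n ω) (n : ℕ) :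
    countN U (psum U n ω) ω = n := by
  have h0 : 0 ≤ psum U n ω := Finset.sum_nonneg fun i _ => (hpos i).le
  obtain ⟨h1, h2⟩ := countN_spec hpos hunb h0
  have h3 := (strictMono_psum hpos).le_iff_le.1 h1
  have h4 := (strictMono_psum hpos).lt_iff_lt.1 h2
  omega

lemma passageT_of_mem_hit (hpos : ∀ i, 0 < U i ω) (hunb : ∀ t, ∃ n, t < psum U n ω) {n : ℕ}
    (hn : ω ∈ hit U D x n) : passageT U D x ω = ENNReal.ofReal (psum U (n + 1) ω) := by
  have hmono := strictMono_psum hpos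
  refine le_antisymm (sInf_le ⟨_, ⟨?_, ?_⟩, rfl⟩) (le_sInf ?_)
  · simpa [psum_zero] using hmono (Nat.succ_pos n)
  · have h : x ≤ psum D (n + 1) ω - psum U (n + 1) ω := hn.2
    rw [procY, countN_psum hpos hunb]
    change x + _ ≤ psum D (n + 1) ω
    linarith
  · rintro _ ⟨t, ⟨ht, hY⟩, rfl⟩
    obtain ⟨h1, -⟩ := countN_spec hpos hunb ht.le
    change x + t ≤ psum D (countN U t ω) ω at hY
    refine ENNReal.ofReal_le_ofReal (le_trans (hmono.le_iff_le.2 ?_) h1)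
    -- If the jump count at time $t$ were at most $n$, the walk would still be below $x$ there,
    -- although $Y(t)\ge x+t$ and $t$ is at least the last jump time.
    by_contra! h
    have := hn.1 (countN U t ω) (by omega)
    linarith

lemma alive_succ (n : ℕ) : alive U D x (n + 1) = alive U D x n \ hit U D x n := by
  ext ω
  constructor
  · intro h
    refine ⟨fun k hk => h k (by omega), fun h' => absurd h'.2 (not_le.2 (h _ le_rfl))⟩
  · rintro ⟨h1, h2⟩ k hk
    rcases Nat.lt_or_ge k (n + 1) with h | h
    · exact h1 k (by omega)
    · obtain rfl : k = n + 1 := by omega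
      by_contra! h3
      exact h2 ⟨h1, h3⟩

lemma pairwise_disjoint_hit : Pairwise (Function.onFun Disjoint (hit U D x)) := by
  have key : ∀ m n, m < n → Disjoint (hit U D x m) (hit U D x n) := fun m n hmn =>
    Set.disjoint_left.2 fun ω hm hn => absurd hm.2 (not_le.2 (hn.1 (m + 1) (by omega)))
  intro m n hmn
  rcases lt_or_gt_of_ne hmn with h | h
  · exact key m n h
  · exact (key n m h).symm

end Paths

/-! ### Exponential integrals. -/

section ExponentialLaw

lemma expE_add (a b : ℝ) : expE (a + b) = expE a * expE b := by
  rw [expE, Real.exp_add, ENNReal.ofReal_mul (Real.exp_pos a).le, expE, expE]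

@[fun_prop]
lemma measurable_expE : Measurable expE := by
  unfold expE
  fun_prop

lemma lintegral_expMeasure {r : ℝ} {f : ℝ → ENNReal} (hf : Measurable f) :
    ∫⁻ z, f z ∂(expMeasure r) =
      ∫⁻ z in Set.Ici 0, ENNReal.ofReal (r * Real.exp (-(r * z))) * f z := by
  have hm : Measurable (gammaPDF 1 r) := by
    unfold gammaPDF
    exact (measurable_gammaPDFReal 1 r).ennreal_ofReal
  rw [expMeasure, gammaMeasure, lintegral_withDensity_eq_lintegral_mul _ hm hf,
    ← lintegral_indicator measurableSet_Ici]
  congr 1 with z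
  by_cases hz : 0 ≤ z
  · rw [Set.indicator_of_mem (show z ∈ Set.Ici (0 : ℝ) from hz), Pi.mul_apply]
    rw [show gammaPDF 1 r z = exponentialPDF r z from rfl, exponentialPDF_of_nonneg hz]
  · rw [Set.indicator_of_notMem (show z ∉ Set.Ici (0 : ℝ) from hz), Pi.mul_apply,
      gammaPDF_of_neg (not_le.1 hz), zero_mul]

/-- With $c=0$ this is the moment generating function, with $a=0$ the tail; together they encode
lack of memory. -/
lemma lintegral_Ici_expE_expMeasure {r a c : ℝ} (hr : 0 < r) (ha : a < r) (hc : 0 ≤ c) :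
    ∫⁻ z, (Set.Ici c).indicator (fun z => expE (a * z)) z ∂(expMeasure r) =
      ENNReal.ofReal (r / (r - a)) * expE (-(r - a) * c) := by
  have hneg : a - r < 0 := by linarith
  rw [lintegral_expMeasure (Measurable.indicator (by fun_prop) measurableSet_Ici)]
  have h1 : ∀ z, ENNReal.ofReal (r * Real.exp (-(r * z))) *
      (Set.Ici c).indicator (fun z => expE (a * z)) z =
      (Set.Ici c).indicator (fun z => ENNReal.ofReal (r * Real.exp ((a - r) * z))) z := by
    intro z
    by_cases hz : z ∈ Set.Ici c
    · rw [Set.indicator_of_mem hz, Set.indicator_of_mem hz, expE,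
        ← ENNReal.ofReal_mul (by positivity), mul_assoc, ← Real.exp_add]
      congr 3
      ring
    · rw [Set.indicator_of_notMem hz, Set.indicator_of_notMem hz, mul_zero]
  simp_rw [h1]
  rw [setLIntegral_indicator measurableSet_Ici,
    Set.inter_eq_left.2 (Set.Ici_subset_Ici.2 hc), setLIntegral_congr Ioi_ae_eq_Ici.symm,
    ← ofReal_integral_eq_lintegral_ofReal ((integrableOn_exp_mul_Ioi hneg c).const_mul r)
      (Filter.Eventually.of_forall fun z => by positivity),
    integral_const_mul, integral_exp_mul_Ioi hneg, expE, ← ENNReal.ofReal_mul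
      (div_nonneg hr.le (by linarith))]
  congr 1
  have h2 : a - r ≠ 0 := hneg.ne
  have h3 : r - a ≠ 0 := by linarith
  rw [show -(r - a) * c = (a - r) * c by ring]
  field_simp
  ring

lemma ae_expMeasure_pos (r : ℝ) : ∀ᵐ z ∂(expMeasure r), 0 < z := by
  have h : (expMeasure r) (Set.Iic 0) = 0 := by
    rw [← lintegral_indicator_one measurableSet_Iic,
      lintegral_expMeasure (measurable_one.indicator measurableSet_Iic)]
    rw [setLIntegral_congr Ioi_ae_eq_Ici.symm]
    refine (setLIntegral_congr_fun (g := fun _ => 0) measurableSet_Ioi fun z hz => ?_).trans (by simp)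
    have : z ∉ Set.Iic (0 : ℝ) := by simpa using hz
    simp [this]
  rw [ae_iff]
  convert h using 2
  ext z
  simp

lemma lintegral_expE_expMeasure {r a : ℝ} (hr : 0 < r) (ha : a < r) :
    ∫⁻ z, expE (a * z) ∂(expMeasure r) = ENNReal.ofReal (r / (r - a)) := by
  have h := lintegral_Ici_expE_expMeasure hr ha le_rfl
  rw [mul_zero, expE, Real.exp_zero, ENNReal.ofReal_one, mul_one] at h
  rw [← h]
  refine lintegral_congr_ae ?_
  filter_upwards [ae_expMeasure_pos r] with z hz
  rw [Set.indicator_of_mem (show z ∈ Set.Ici (0 : ℝ) from hz.le)]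

end ExponentialLaw

end AlternatingMotion

/-! ### The filtration of the interleaved periods, and independence. -/

namespace AlternatingMotion

/-- The place of each period in the order `U 0, D 0, U 1, D 1, …`. -/
def rank : ℕ ⊕ ℕ → ℕ := Sum.elim (fun i => 2 * i) (fun i => 2 * i + 1)

/-- The σ-algebra generated by the first `m` of the periods `U 0, D 0, U 1, D 1, …`. -/
@[reducible] def past {Ω : Type*} (U D : ℕ → Ω → ℝ) (m : ℕ) : MeasurableSpace Ω :=
  ⨆ j ∈ {j | rank j < m}, MeasurableSpace.comap (Sum.elim U D j : Ω → ℝ) inferInstance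

/-- Measurable independent periods with exponential laws of rates `lam` and `mu`. -/
structure IsModel {Ω : Type*} [MeasurableSpace Ω] (P : Measure Ω) (lam mu : ℝ)
    (U D : ℕ → Ω → ℝ) : Prop where
  lam_pos : 0 < lam
  mu_pos : 0 < mu
  measurable_up : ∀ i, Measurable (U i)
  measurable_down : ∀ i, Measurable (D i)
  map_up : ∀ i, P.map (U i) = expMeasure lam
  map_down : ∀ i, P.map (D i) = expMeasure mu
  indep : iIndepFun (Sum.elim U D : ℕ ⊕ ℕ → Ω → ℝ) P

section Measurability

variable {Ω : Type*} {U D : ℕ → Ω → ℝ}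

lemma past_mono {m n : ℕ} (h : m ≤ n) : past U D m ≤ past U D n :=
  biSup_mono fun _ hj => lt_of_lt_of_le hj h

lemma measurable_past_up {i m : ℕ} (h : 2 * i < m) : Measurable[past U D m] (U i) :=
  measurable_iff_comap_le.2 (le_iSup₂_of_le (Sum.inl i) h le_rfl)

lemma measurable_past_down {i m : ℕ} (h : 2 * i + 1 < m) : Measurable[past U D m] (D i) :=
  measurable_iff_comap_le.2 (le_iSup₂_of_le (Sum.inr i) h le_rfl)

lemma measurable_psum {_ : MeasurableSpace Ω} {V : ℕ → Ω → ℝ} {n : ℕ}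
    (h : ∀ i < n, Measurable (V i)) : Measurable (psum V n) := by
  unfold psum
  exact Finset.measurable_fun_sum _ fun i hi => h i (Finset.mem_range.1 hi)

lemma measurable_past_psum_up (n : ℕ) : Measurable[past U D (2 * n)] (psum U n) :=
  measurable_psum fun i hi => measurable_past_up (by omega)

lemma measurable_past_psum_down (n : ℕ) : Measurable[past U D (2 * n)] (psum D n) :=
  measurable_psum fun i hi => measurable_past_down (by omega)

lemma measurableSet_past_alive (x : ℝ) (n : ℕ) :
    MeasurableSet[past U D (2 * n)] (alive U D x n) := by
  have : alive U D x n = ⋂ k ∈ Set.Iic n, {ω | psum D k ω - psum U k ω < x} := by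
    ext ω
    simp [alive]
  rw [this]
  refine @MeasurableSet.biInter _ _ (past U D (2 * n)) _ _ (Set.to_countable _) fun k hk => ?_
  have hle : past U D (2 * k) ≤ past U D (2 * n) :=
    past_mono (Nat.mul_le_mul_left 2 hk)
  have hsub : Measurable[past U D (2 * n)] fun ω => psum D k ω - psum U k ω :=
    Measurable.sub ((measurable_past_psum_down k).mono hle le_rfl)
      ((measurable_past_psum_up k).mono hle le_rfl)
  exact hsub measurableSet_Iio

end Measurability

namespace IsModel

variable {Ω : Type*} [MeasurableSpace Ω] {P : Measure Ω} {lam mu : ℝ}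
  {U D : ℕ → Ω → ℝ}

lemma measurable_elim (h : IsModel P lam mu U D) (j : ℕ ⊕ ℕ) :
    Measurable (Sum.elim U D j : Ω → ℝ) := by
  cases j with
  | inl i => exact h.measurable_up i
  | inr i => exact h.measurable_down i

lemma past_le (h : IsModel P lam mu U D) (m : ℕ) : past U D m ≤ ‹MeasurableSpace Ω› :=
  iSup₂_le fun j _ => (h.measurable_elim j).comap_le

lemma measurable_psum_up (h : IsModel P lam mu U D) (n : ℕ) : Measurable (psum U n) :=
  measurable_psum fun i _ => h.measurable_up i

lemma measurable_psum_down (h : IsModel P lam mu U D) (n : ℕ) : Measurable (psum D n) :=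
  measurable_psum fun i _ => h.measurable_down i

lemma measurableSet_alive (h : IsModel P lam mu U D) (x : ℝ) (n : ℕ) :
    MeasurableSet (alive U D x n) :=
  h.past_le _ _ (measurableSet_past_alive x n)

lemma measurableSet_hit (h : IsModel P lam mu U D) (x : ℝ) (n : ℕ) :
    MeasurableSet (hit U D x n) :=
  (h.measurableSet_alive x n).inter (measurableSet_le measurable_const
    ((h.measurable_psum_down _).sub (h.measurable_psum_up _)))

lemma indep_past (h : IsModel P lam mu U D) (j : ℕ ⊕ ℕ) :
    Indep (past U D (rank j))
      (MeasurableSpace.comap (Sum.elim U D j : Ω → ℝ) inferInstance) P := by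
  have h1 := indep_iSup_of_disjoint (fun i => (h.measurable_elim i).comap_le) h.indep.iIndep
    (S := {i | rank i < rank j}) (T := {j})
    (Set.disjoint_singleton_right.2 fun hj => lt_irrefl (rank j) hj)
  simp only [Set.mem_singleton_iff, iSup_iSup_eq_left] at h1
  exact h1

lemma lintegral_past_mul (h : IsModel P lam mu U D) (j : ℕ ⊕ ℕ) {Q : Ω → ENNReal}
    (hQ : Measurable[past U D (rank j)] Q) {g : ℝ → ENNReal} (hg : Measurable g) :
    ∫⁻ ω, Q ω * g (Sum.elim U D j ω) ∂P =
      (∫⁻ ω, Q ω ∂P) * ∫⁻ z, g z ∂(P.map (Sum.elim U D j : Ω → ℝ)) := by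
  rw [lintegral_map hg (h.measurable_elim j)]
  exact lintegral_mul_eq_lintegral_mul_lintegral_of_independent_measurableSpace
    (h.past_le _) (h.measurable_elim j).comap_le (h.indep_past j) hQ
    (hg.comp (comap_measurable _))

lemma lintegral_past_mul_expE (h : IsModel P lam mu U D) {n : ℕ} {Q : Ω → ENNReal}
    (hQ : Measurable[past U D (2 * n)] Q) {a b : ℝ} (ha : a < lam) (hb : b < mu) :
    ∫⁻ ω, Q ω * expE (a * U n ω + b * D n ω) ∂P =
      (∫⁻ ω, Q ω ∂P) * ENNReal.ofReal (lam / (lam - a) * (mu / (mu - b))) := by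
  have hm : Measurable[past U D (2 * n + 1)] fun ω => Q ω * expE (a * U n ω) :=
    (hQ.mono (past_mono (by omega)) le_rfl).mul
      (measurable_expE.comp ((measurable_past_up (by omega)).const_mul a))
  have h1 := h.lintegral_past_mul (Sum.inr n) hm (g := fun z => expE (b * z)) (by fun_prop)
  have h2 := h.lintegral_past_mul (Sum.inl n) hQ (g := fun z => expE (a * z)) (by fun_prop)
  simp only [Sum.elim_inr, Sum.elim_inl] at h1 h2
  rw [h.map_down, lintegral_expE_expMeasure h.mu_pos hb] at h1
  rw [h.map_up, lintegral_expE_expMeasure h.lam_pos ha] at h2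
  simp_rw [expE_add, ← mul_assoc]
  rw [h1, h2, mul_assoc, ← ENNReal.ofReal_mul
    (div_nonneg h.lam_pos.le (by linarith))]

variable [IsProbabilityMeasure P]

/-- The lack of memory of the downward period `D n`. -/
lemma lintegral_overshoot (h : IsModel P lam mu U D) {n : ℕ} {Q : Ω → ENNReal} {c : Ω → ℝ}
    (hQ : Measurable[past U D (2 * n + 1)] Q) (hc : Measurable[past U D (2 * n + 1)] c)
    (hpos : ∀ᵐ ω ∂P, Q ω ≠ 0 → 0 ≤ c ω) {b : ℝ} (hb : b < mu) :
    ∫⁻ ω, Q ω * (Set.Ici (c ω)).indicator (fun z => expE (b * z)) (D n ω) ∂P =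
      ENNReal.ofReal (mu / (mu - b)) *
        ∫⁻ ω, Q ω * expE (b * c ω) * (Set.Ici (c ω)).indicator 1 (D n ω) ∂P := by
  -- The pair $(Q,c)$ is independent of `D n`, so their joint law is a product and `D n` can be
  -- integrated out first.
  have key : ∀ G : ENNReal × ℝ → ℝ → ENNReal, Measurable (Function.uncurry G) →
      ∫⁻ ω, G (Q ω, c ω) (D n ω) ∂P = ∫⁻ ω, ∫⁻ z, G (Q ω, c ω) z ∂(expMeasure mu) ∂P := by
    intro G hG
    have hpair : Measurable[past U D (2 * n + 1)] fun ω => (Q ω, c ω) := hQ.prodMk hc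
    have hpair' : Measurable fun ω => (Q ω, c ω) := hpair.mono (h.past_le _) le_rfl
    have hind : IndepFun (fun ω => (Q ω, c ω)) (D n) P :=
      (IndepFun_iff_Indep _ _ _).2
        (indep_of_indep_of_le_left (h.indep_past (Sum.inr n)) hpair.comap_le)
    have := isProbabilityMeasure_expMeasure h.mu_pos
    have hlaw := (indepFun_iff_map_prod_eq_prod_map_map hpair'.aemeasurable
      (h.measurable_down n).aemeasurable).1 hind
    rw [h.map_down n] at hlaw
    calc ∫⁻ ω, G (Q ω, c ω) (D n ω) ∂P
        = ∫⁻ p, Function.uncurry G p ∂(P.map fun ω => ((Q ω, c ω), D n ω)) :=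
          (lintegral_map hG (hpair'.prodMk (h.measurable_down n))).symm
      _ = ∫⁻ q, ∫⁻ z, G q z ∂(expMeasure mu) ∂(P.map fun ω => (Q ω, c ω)) := by
          rw [hlaw, lintegral_prod _ hG.aemeasurable]
          rfl
      _ = _ := lintegral_map hG.lintegral_prod_right' hpair'
  have hset : MeasurableSet {p : (ENNReal × ℝ) × ℝ | p.1.2 ≤ p.2} :=
    measurableSet_le (by fun_prop) (by fun_prop)
  have e1 := key (fun q z => q.1 * (Set.Ici q.2).indicator (fun z => expE (b * z)) z)
    (measurable_fst.fst.mul (Measurable.indicator (f := fun p : (ENNReal × ℝ) × ℝ => expE (b * p.2))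
      (by fun_prop) hset))
  have e2 := key (fun q z => q.1 * expE (b * q.2) * (Set.Ici q.2).indicator 1 z)
    (Measurable.mul (by fun_prop) (Measurable.indicator (f := fun _ : (ENNReal × ℝ) × ℝ => 1)
      (by fun_prop) hset))
  dsimp only at e1 e2
  rw [e1, e2, ← lintegral_const_mul' _ _ ENNReal.ofReal_ne_top]
  refine lintegral_congr_ae ?_
  filter_upwards [hpos] with ω hω
  rw [lintegral_const_mul _ (Measurable.indicator (by fun_prop) measurableSet_Ici),
    lintegral_const_mul _ (measurable_one.indicator measurableSet_Ici)]
  by_cases hQ0 : Q ω = 0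
  · simp [hQ0]
  have hc0 := hω hQ0
  have h0 := lintegral_Ici_expE_expMeasure h.mu_pos h.mu_pos hc0
  rw [sub_zero, div_self h.mu_pos.ne', ENNReal.ofReal_one, one_mul] at h0
  have h1 : (fun z : ℝ => expE (0 * z)) = 1 := by
    ext z
    simp [expE]
  rw [h1] at h0
  rw [lintegral_Ici_expE_expMeasure h.mu_pos hb hc0, h0,
    show -(mu - b) * c ω = b * c ω + -mu * c ω by ring, expE_add]
  ring

end IsModel

end AlternatingMotion

/-! ### The exponential martingale and its value at the hitting time. -/

namespace AlternatingMotion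

lemma expE_zero : expE 0 = 1 := by simp [expE]

lemma expE_lt_iff {a b : ℝ} : expE a < expE b ↔ a < b := by
  rw [expE, expE, ENNReal.ofReal_lt_ofReal_iff (Real.exp_pos b), Real.exp_lt_exp]

lemma expE_mono {a b : ℝ} (h : a ≤ b) : expE a ≤ expE b :=
  ENNReal.ofReal_le_ofReal (Real.exp_le_exp.2 h)

lemma passageT_congr {Ω : Type*} {U D U' D' : ℕ → Ω → ℝ} {x : ℝ} {ω : Ω}
    (hU : ∀ i, U i ω = U' i ω) (hD : ∀ i, D i ω = D' i ω) :
    passageT U D x ω = passageT U' D' x ω := by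
  simp only [passageT, procY, countN, hU, hD]

section Weights

variable {Ω : Type*} {U D : ℕ → Ω → ℝ}

lemma measurable_past_weight (a b : ℝ) (n : ℕ) :
    Measurable[past U D (2 * n)] fun ω => expE (a * psum U n ω + b * psum D n ω) :=
  measurable_expE.comp (Measurable.add ((measurable_past_psum_up n).const_mul a)
    ((measurable_past_psum_down n).const_mul b))

lemma expE_psum_succ (a b : ℝ) (n : ℕ) (ω : Ω) :
    expE (a * psum U (n + 1) ω + b * psum D (n + 1) ω) =
      expE (a * psum U n ω + b * psum D n ω) * expE (a * U n ω + b * D n ω) := by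
  rw [← expE_add, psum_succ, psum_succ]
  congr 1
  ring

end Weights

namespace IsModel

variable {Ω : Type*} [MeasurableSpace Ω] {P : Measure Ω} {lam mu : ℝ}
  {U D : ℕ → Ω → ℝ}

lemma ae_up_pos (h : IsModel P lam mu U D) : ∀ᵐ ω ∂P, ∀ i, 0 < U i ω := by
  refine ae_all_iff.2 fun i => ?_
  have h1 := ae_expMeasure_pos lam
  rw [← h.map_up i] at h1
  exact ae_of_ae_map (h.measurable_up i).aemeasurable h1

/-- One martingale step: `hab` says that the new factor has mean one, and `alive` at time $n$ is
split by whether the next step hits. -/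
lemma setLIntegral_alive_succ (h : IsModel P lam mu U D) {a b : ℝ} (ha : a < lam) (hb : b < mu)
    (hab : lam / (lam - a) * (mu / (mu - b)) = 1) (x : ℝ) (n : ℕ) :
    ∫⁻ ω in hit U D x n, expE (a * psum U (n + 1) ω + b * psum D (n + 1) ω) ∂P +
      ∫⁻ ω in alive U D x (n + 1), expE (a * psum U (n + 1) ω + b * psum D (n + 1) ω) ∂P =
      ∫⁻ ω in alive U D x n, expE (a * psum U n ω + b * psum D n ω) ∂P := by
  have hsub : hit U D x n = alive U D x n ∩ hit U D x n :=
    (Set.inter_eq_right.2 fun ω hω => hω.1).symm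
  rw [hsub, alive_succ, lintegral_inter_add_sdiff _ _ (h.measurableSet_hit x n),
    ← lintegral_indicator (h.measurableSet_alive x n),
    ← lintegral_indicator (h.measurableSet_alive x n)]
  have hQ : Measurable[past U D (2 * n)]
      ((alive U D x n).indicator fun ω => expE (a * psum U n ω + b * psum D n ω)) :=
    (measurable_past_weight a b n).indicator (measurableSet_past_alive x n)
  have := h.lintegral_past_mul_expE hQ ha hb
  rw [hab, ENNReal.ofReal_one, mul_one] at this
  rw [← this]
  congr 1 with ω
  by_cases hω : ω ∈ alive U D x n
  · rw [Set.indicator_of_mem hω, Set.indicator_of_mem hω, expE_psum_succ]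
  · rw [Set.indicator_of_notMem hω, Set.indicator_of_notMem hω, zero_mul]

variable [IsProbabilityMeasure P]

lemma lintegral_weight (h : IsModel P lam mu U D) {a b : ℝ} (ha : a < lam) (hb : b < mu) (n : ℕ) :
    ∫⁻ ω, expE (a * psum U n ω + b * psum D n ω) ∂P =
      ENNReal.ofReal (lam / (lam - a) * (mu / (mu - b))) ^ n := by
  induction n with
  | zero => simp [psum_zero, expE_zero]
  | succ n ih =>
    simp_rw [expE_psum_succ]
    rw [h.lintegral_past_mul_expE (measurable_past_weight a b n) ha hb, ih, pow_succ]

/-- The expectations of $e^{-(U_1+\dots+U_n)}$ form a convergent geometric series, so these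
variables tend to 0 almost surely. -/
lemma ae_psum_unbounded (h : IsModel P lam mu U D) :
    ∀ᵐ ω ∂P, ∀ t, ∃ n, t < psum U n ω := by
  have hl := h.lam_pos
  have hmeas : ∀ n, Measurable fun ω => expE (-1 * psum U n ω + 0 * psum D n ω) := fun n =>
    (measurable_past_weight (-1) 0 n).mono (h.past_le _) le_rfl
  have hsum : ∫⁻ ω, ∑' n, expE (-1 * psum U n ω + 0 * psum D n ω) ∂P ≠ ⊤ := by
    rw [lintegral_tsum fun n => (hmeas n).aemeasurable]
    simp_rw [h.lintegral_weight (show (-1 : ℝ) < lam by linarith) h.mu_pos]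
    rw [ENNReal.tsum_geometric]
    refine ENNReal.inv_ne_top.2 (tsub_pos_of_lt ?_).ne'
    rw [ENNReal.ofReal_lt_one, sub_zero, div_self h.mu_pos.ne', mul_one,
      div_lt_one (by linarith)]
    linarith
  filter_upwards [ae_lt_top (Measurable.tsum hmeas) hsum] with ω hω t
  have hlim := ENNReal.tendsto_atTop_zero_of_tsum_ne_top hω.ne
  have hpos : (0 : ENNReal) < expE (-t) := ENNReal.ofReal_pos.2 (Real.exp_pos _)
  obtain ⟨n, hn⟩ := (hlim.eventually (gt_mem_nhds hpos)).exists
  refine ⟨n, ?_⟩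
  have := expE_lt_iff.1 hn
  linarith

lemma setLIntegral_hit (h : IsModel P lam mu U D) {s b : ℝ} (hb : b < mu) (x : ℝ) (n : ℕ) :
    ∫⁻ ω in hit U D x n, expE ((s - b) * psum U (n + 1) ω + b * psum D (n + 1) ω) ∂P =
      ENNReal.ofReal (mu / (mu - b)) * expE (b * x) *
        ∫⁻ ω in hit U D x n, expE (s * psum U (n + 1) ω) ∂P := by
  set Q : Ω → ENNReal := fun ω =>
    (alive U D x n).indicator (fun ω => expE ((s - b) * psum U n ω + b * psum D n ω)) ω *
      expE ((s - b) * U n ω) with hQdef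
  -- The level that `D n` must reach for a hit; it is known once `U n` is, hence the index $2n+1$.
  set c : Ω → ℝ := fun ω => x - psum D n ω + psum U n ω + U n ω with hcdef
  have hle : past U D (2 * n) ≤ past U D (2 * n + 1) := past_mono (by omega)
  have hU : Measurable[past U D (2 * n + 1)] (U n) := measurable_past_up (by omega)
  have hQ : Measurable[past U D (2 * n + 1)] Q :=
    (((measurable_past_weight (s - b) b n).indicator (measurableSet_past_alive x n)).mono
      hle le_rfl).mul (measurable_expE.comp (hU.const_mul _))
  have hc : Measurable[past U D (2 * n + 1)] c :=
    ((measurable_const.sub ((measurable_past_psum_down n).mono hle le_rfl)).add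
      ((measurable_past_psum_up n).mono hle le_rfl)).add hU
  have hpos : ∀ᵐ ω ∂P, Q ω ≠ 0 → 0 ≤ c ω := by
    filter_upwards [h.ae_up_pos] with ω hω hQω
    have hal : ω ∈ alive U D x n := by
      by_contra hal
      exact hQω (by rw [hQdef]; simp [hal])
    have h1 := hal n le_rfl
    have h2 := hω n
    rw [hcdef]
    dsimp only
    linarith
  have hmem : ∀ ω, ω ∈ alive U D x n → (ω ∈ hit U D x n ↔ D n ω ∈ Set.Ici (c ω)) := by
    intro ω hω
    rw [hit, Set.mem_ofPred_eq, and_iff_right hω, psum_succ, psum_succ, hcdef, Set.mem_Ici]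
    constructor <;> intro h3 <;> dsimp only at * <;> linarith
  have key := h.lintegral_overshoot hQ hc hpos hb
  rw [← lintegral_indicator (h.measurableSet_hit x n),
    ← lintegral_indicator (h.measurableSet_hit x n), mul_assoc,
    ← lintegral_const_mul' (expE (b * x)) _ ENNReal.ofReal_ne_top]
  convert key using 1
  · congr 1 with ω
    by_cases hal : ω ∈ alive U D x n
    · by_cases hh : ω ∈ hit U D x n
      · rw [Set.indicator_of_mem hh, Set.indicator_of_mem ((hmem ω hal).1 hh), hQdef]
        dsimp only
        rw [Set.indicator_of_mem hal, mul_assoc, ← expE_add, expE_psum_succ]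
      · rw [Set.indicator_of_notMem hh,
          Set.indicator_of_notMem (fun h3 => hh ((hmem ω hal).2 h3)), mul_zero]
    · rw [Set.indicator_of_notMem (fun hh => hal hh.1), hQdef]
      simp [hal]
  · congr 2 with ω
    by_cases hal : ω ∈ alive U D x n
    · by_cases hh : ω ∈ hit U D x n
      · rw [Set.indicator_of_mem hh, Set.indicator_of_mem ((hmem ω hal).1 hh), hQdef]
        dsimp only
        rw [Set.indicator_of_mem hal, Pi.one_apply, mul_one, ← expE_add, ← expE_add, ← expE_add,
          psum_succ, hcdef]
        congr 1
        ring
      · rw [Set.indicator_of_notMem hh,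
          Set.indicator_of_notMem (fun h3 => hh ((hmem ω hal).2 h3)), mul_zero, mul_zero]
    · rw [Set.indicator_of_notMem (fun hh => hal hh.1), hQdef]
      simp [hal]

/-- Below $x$, moving $\varepsilon$ from $b$ to $a$ costs at most a factor $e^{\varepsilon x}$, and
the shifted weights have geometrically decaying means. -/
lemma tendsto_setLIntegral_alive (h : IsModel P lam mu U D) {a b ε : ℝ} (hε : 0 ≤ ε)
    (ha : a + ε < lam) (hb : b - ε < mu)
    (hab : lam / (lam - (a + ε)) * (mu / (mu - (b - ε))) < 1) (x : ℝ) :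
    Filter.Tendsto (fun n => ∫⁻ ω in alive U D x n,
      expE (a * psum U n ω + b * psum D n ω) ∂P) Filter.atTop (nhds 0) := by
  have hlim : Filter.Tendsto (fun n : ℕ => expE (ε * x) *
      ENNReal.ofReal (lam / (lam - (a + ε)) * (mu / (mu - (b - ε)))) ^ n)
      Filter.atTop (nhds 0) := by
    have := ENNReal.Tendsto.const_mul (a := expE (ε * x))
      (ENNReal.tendsto_pow_atTop_nhds_zero_of_lt_one (ENNReal.ofReal_lt_one.2 hab))
      (Or.inr ENNReal.ofReal_ne_top)
    rwa [mul_zero] at this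
  refine tendsto_of_tendsto_of_tendsto_of_le_of_le tendsto_const_nhds hlim
    (fun _ => zero_le) fun n => ?_
  dsimp only
  rw [← h.lintegral_weight ha hb n, ← lintegral_const_mul' (expE (ε * x)) _ ENNReal.ofReal_ne_top]
  refine le_trans (setLIntegral_mono_ae' (h.measurableSet_alive x n)
    (Filter.Eventually.of_forall fun ω hω => ?_)) (setLIntegral_le_lintegral _ _)
  rw [← expE_add]
  have h1 := hω n le_rfl
  refine expE_mono ?_
  nlinarith [mul_le_mul_of_nonneg_left h1.le hε]

lemma tsum_setLIntegral_hit (h : IsModel P lam mu U D) {a b ε : ℝ} (hε : 0 ≤ ε)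
    (ha : a + ε < lam) (hb : b < mu) (hab : lam / (lam - a) * (mu / (mu - b)) = 1)
    (hab' : lam / (lam - (a + ε)) * (mu / (mu - (b - ε))) < 1) {x : ℝ} (hx : 0 < x) :
    ∑' n, ∫⁻ ω in hit U D x n, expE (a * psum U (n + 1) ω + b * psum D (n + 1) ω) ∂P = 1 := by
  have hpart : ∀ N, ∑ n ∈ Finset.range N,
      ∫⁻ ω in hit U D x n, expE (a * psum U (n + 1) ω + b * psum D (n + 1) ω) ∂P +
      ∫⁻ ω in alive U D x N, expE (a * psum U N ω + b * psum D N ω) ∂P = 1 := by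
    intro N
    induction N with
    | zero =>
      have : alive U D x 0 = Set.univ := Set.eq_univ_of_forall fun ω k hk => by
        obtain rfl : k = 0 := by omega
        simpa [psum_zero] using hx
      simp [this, psum_zero, expE_zero]
    | succ N ih =>
      rw [Finset.sum_range_succ, add_assoc,
        h.setLIntegral_alive_succ (by linarith) hb hab, ih]
  have h1 := ENNReal.summable.hasSum.tendsto_sum_nat (f := fun n =>
    ∫⁻ ω in hit U D x n, expE (a * psum U (n + 1) ω + b * psum D (n + 1) ω) ∂P)
  have h2 := h1.add (h.tendsto_setLIntegral_alive hε ha (by linarith) hab' x)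
  simp_rw [hpart, add_zero] at h2
  exact tendsto_nhds_unique h2 tendsto_const_nhds |>.symm ▸ rfl

lemma tsum_setLIntegral_expE_up (h : IsModel P lam mu U D) {s r x : ℝ} (hr : 0 < r)
    (hrp : r < lam + mu - s) (hrel : (lam + mu - s) ^ 2 - 4 * lam * mu = r ^ 2) (hx : 0 < x) :
    ∑' n, ∫⁻ ω in hit U D x n, expE (s * psum U (n + 1) ω) ∂P =
      ENNReal.ofReal ((lam + mu - s - r) / (2 * mu) * Real.exp (x / 2 * (lam - mu - s - r))) := by
  have hl := h.lam_pos
  have hm := h.mu_pos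
  -- The larger root of $(\lambda-s+b)(\mu-b)=\lambda\mu$. Shifting by $\varepsilon=r/2$ makes both
  -- factors equal to $(\lambda+\mu-s)/2$, whose square exceeds $\lambda\mu$; the smaller root would
  -- require $\varepsilon<0$.
  set b : ℝ := (s + mu - lam + r) / 2 with hb
  have e1 : lam - (s - b) = (lam + mu - s + r) / 2 := by rw [hb]; ring
  have e2 : mu - b = (lam + mu - s - r) / 2 := by rw [hb]; ring
  have e3 : lam - (s - b + r / 2) = (lam + mu - s) / 2 := by rw [hb]; ring
  have e4 : mu - (b - r / 2) = (lam + mu - s) / 2 := by rw [hb]; ring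
  have p1 : 0 < lam - (s - b) := by linarith
  have p2 : 0 < mu - b := by linarith
  have p3 : 0 < lam - (s - b + r / 2) := by linarith
  have key := h.tsum_setLIntegral_hit (a := s - b) (b := b) (ε := r / 2) (by linarith)
    (by linarith) (by linarith)
    (by
      rw [div_mul_div_comm, div_eq_one_iff_eq (by positivity), e1, e2]
      nlinarith)
    (by
      rw [div_mul_div_comm, div_lt_one (by rw [e3, e4]; nlinarith), e3, e4]
      nlinarith [sq_pos_of_pos hr]) hx
  simp_rw [h.setLIntegral_hit (show b < mu by linarith)] at key
  rw [ENNReal.tsum_mul_left, expE, ← ENNReal.ofReal_mul (by positivity)] at key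
  have hK : 0 < mu / (mu - b) * Real.exp (b * x) := by positivity
  rw [ENNReal.eq_inv_of_mul_eq_one_left ((mul_comm _ _).trans key),
    ← ENNReal.ofReal_inv_of_pos hK, mul_inv, ← Real.exp_neg, inv_div, e2]
  congr 1
  rw [div_div, show -(b * x) = x / 2 * (lam - mu - s - r) by rw [hb]; ring]

/-- At $s=0$ the root is $r=\lambda-\mu$, because $\mu<\lambda$, and the hitting probabilities sum
to 1. -/
lemma ae_mem_iUnion_hit (h : IsModel P lam mu U D) (hlam : mu < lam) {x : ℝ} (hx : 0 < x) :
    ∀ᵐ ω ∂P, ω ∈ ⋃ n, hit U D x n := by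
  have hm := h.mu_pos
  have key := h.tsum_setLIntegral_expE_up (s := 0) (r := lam - mu) (by linarith) (by linarith)
    (by ring) hx
  have hval : (lam + mu - 0 - (lam - mu)) / (2 * mu) *
      Real.exp (x / 2 * (lam - mu - 0 - (lam - mu))) = 1 := by
    rw [show lam + mu - 0 - (lam - mu) = 2 * mu by ring,
      show x / 2 * (lam - mu - 0 - (lam - mu)) = 0 by ring, Real.exp_zero, mul_one,
      div_self (by positivity)]
  simp_rw [hval, zero_mul, expE_zero, setLIntegral_one, ENNReal.ofReal_one] at key
  rw [← measure_iUnion pairwise_disjoint_hit (h.measurableSet_hit x)] at key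
  exact (mem_ae_iff_prob_eq_one (MeasurableSet.iUnion (h.measurableSet_hit x))).2 key

lemma ae_passageT_eq (h : IsModel P lam mu U D) (hlam : mu < lam) {x : ℝ} (hx : 0 < x) :
    ∀ᵐ ω ∂P, ∃ n, ω ∈ hit U D x n ∧
      passageT U D x ω = ENNReal.ofReal (psum U (n + 1) ω) := by
  filter_upwards [h.ae_mem_iUnion_hit hlam hx, h.ae_up_pos, h.ae_psum_unbounded] with ω h1 h2 h3
  obtain ⟨n, hn⟩ := Set.mem_iUnion.1 h1
  exact ⟨n, hn, passageT_of_mem_hit h2 h3 hn⟩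

lemma aemeasurable_passageT (h : IsModel P lam mu U D) (hlam : mu < lam) {x : ℝ} (hx : 0 < x) :
    AEMeasurable (passageT U D x) P := by
  refine ⟨fun ω => ∑' n, (hit U D x n).indicator
    (fun ω => ENNReal.ofReal (psum U (n + 1) ω)) ω, Measurable.tsum fun n =>
      (h.measurable_psum_up _).ennreal_ofReal.indicator (h.measurableSet_hit x n), ?_⟩
  filter_upwards [h.ae_passageT_eq hlam hx] with ω ⟨n, hn, hT⟩
  rw [hT, tsum_eq_single n, Set.indicator_of_mem hn]
  intro m hm
  exact Set.indicator_of_notMem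
    (fun h' => Set.disjoint_left.1 (pairwise_disjoint_hit hm) h' hn) _

lemma lintegral_expE_passageT (h : IsModel P lam mu U D) (hlam : mu < lam) {s r x : ℝ}
    (hr : 0 < r) (hrp : r < lam + mu - s)
    (hrel : (lam + mu - s) ^ 2 - 4 * lam * mu = r ^ 2) (hx : 0 < x) :
    ∫⁻ ω, expE (s * (passageT U D x ω).toReal) ∂P =
      ENNReal.ofReal ((lam + mu - s - r) / (2 * mu) * Real.exp (x / 2 * (lam - mu - s - r))) := by
  rw [← h.tsum_setLIntegral_expE_up hr hrp hrel hx,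
    ← Measure.restrict_eq_self_of_ae_mem (h.ae_mem_iUnion_hit hlam hx),
    lintegral_iUnion (h.measurableSet_hit x) pairwise_disjoint_hit,
    Measure.restrict_eq_self_of_ae_mem (h.ae_mem_iUnion_hit hlam hx)]
  congr 1 with n
  refine setLIntegral_congr_fun_ae (h.measurableSet_hit x n) ?_
  filter_upwards [h.ae_up_pos, h.ae_psum_unbounded] with ω h2 h3 hn
  rw [passageT_of_mem_hit h2 h3 hn, ENNReal.toReal_ofReal]
  exact Finset.sum_nonneg fun i _ => (h2 i).le

end IsModel

end AlternatingMotion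

/-! ### Conclusion for almost everywhere measurable periods. -/

theorem mainTheorem8 {Ω : Type*} [MeasurableSpace Ω] (P : Measure Ω) [IsProbabilityMeasure P]
    (lam mu : ℝ) (hmu : 0 < mu) (hlam : mu < lam)
    (U D : ℕ → Ω → ℝ)
    (hU : ∀ i, HasLaw (U i) (expMeasure lam) P)
    (hD : ∀ i, HasLaw (D i) (expMeasure mu) P)
    (hindep : iIndepFun (Sum.elim U D : ℕ ⊕ ℕ → Ω → ℝ) P)
    (x : ℝ) (hx : 0 < x) (s : ℝ) (hs : s < (√lam - √mu) ^ 2) :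
    (∀ᵐ ω ∂P, AlternatingMotion.passageT U D x ω < ⊤) ∧
    Integrable (fun ω => Real.exp (s * (AlternatingMotion.passageT U D x ω).toReal)) P ∧
    mgf (fun ω => (AlternatingMotion.passageT U D x ω).toReal) P s =
      (lam + mu - s - √((lam + mu - s) ^ 2 - 4 * lam * mu)) / (2 * mu) *
        Real.exp (x / 2 * (lam - mu - s - √((lam + mu - s) ^ 2 - 4 * lam * mu))) := by
  have hl : 0 < lam := hmu.trans hlam
  -- `HasLaw` gives only a.e. measurability, so measurable versions are used; this changes $T_x$ on
  -- a null set.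
  set U' : ℕ → Ω → ℝ := fun i => (hU i).aemeasurable.mk (U i)
  set D' : ℕ → Ω → ℝ := fun i => (hD i).aemeasurable.mk (D i)
  have hUU : ∀ i, U i =ᵐ[P] U' i := fun i => (hU i).aemeasurable.ae_eq_mk
  have hDD : ∀ i, D i =ᵐ[P] D' i := fun i => (hD i).aemeasurable.ae_eq_mk
  have hmodel : AlternatingMotion.IsModel P lam mu U' D' :=
    { lam_pos := hl
      mu_pos := hmu
      measurable_up := fun i => (hU i).aemeasurable.measurable_mk
      measurable_down := fun i => (hD i).aemeasurable.measurable_mk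
      map_up := fun i => (Measure.map_congr (hUU i)).symm.trans (hU i).map_eq
      map_down := fun i => (Measure.map_congr (hDD i)).symm.trans (hD i).map_eq
      indep := hindep.congr fun j => by
        cases j with
        | inl i => exact hUU i
        | inr i => exact hDD i }
  have hT : AlternatingMotion.passageT U D x =ᵐ[P] AlternatingMotion.passageT U' D' x := by
    filter_upwards [ae_all_iff.2 hUU, ae_all_iff.2 hDD] with ω h1 h2
    exact AlternatingMotion.passageT_congr h1 h2
  -- This is the bound on $s$ with the square expanded; it makes the discriminant positive.
  have hp : 2 * (√lam * √mu) < lam + mu - s := by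
    nlinarith [Real.sq_sqrt hl.le, Real.sq_sqrt hmu.le]
  have hp0 : 0 < √lam * √mu := mul_pos (Real.sqrt_pos.2 hl) (Real.sqrt_pos.2 hmu)
  have hprod : (√lam * √mu) ^ 2 = lam * mu := by
    rw [mul_pow, Real.sq_sqrt hl.le, Real.sq_sqrt hmu.le]
  have hdisc : 0 < (lam + mu - s) ^ 2 - 4 * lam * mu := by nlinarith
  set r := √((lam + mu - s) ^ 2 - 4 * lam * mu) with hrdef
  have hr : 0 < r := Real.sqrt_pos.2 hdisc
  have hrel : (lam + mu - s) ^ 2 - 4 * lam * mu = r ^ 2 := (Real.sq_sqrt hdisc.le).symm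
  have hrp : r < lam + mu - s := by
    rw [hrdef, Real.sqrt_lt' (by linarith)]
    nlinarith [mul_pos hl hmu]
  have hlint := (lintegral_congr_ae
    (hT.fun_comp fun T => AlternatingMotion.expE (s * T.toReal))).trans
      (hmodel.lintegral_expE_passageT hlam hr hrp hrel hx)
  have hmeas : AEStronglyMeasurable
      (fun ω => Real.exp (s * (AlternatingMotion.passageT U D x ω).toReal)) P := by
    have h1 : AEMeasurable (AlternatingMotion.passageT U D x) P :=
      (hmodel.aemeasurable_passageT hlam hx).congr hT.symm
    exact (Real.measurable_exp.comp_aemeasurable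
      (h1.ennreal_toReal.const_mul s)).aestronglyMeasurable
  have hnonneg : 0 ≤ᵐ[P] fun ω =>
      Real.exp (s * (AlternatingMotion.passageT U D x ω).toReal) :=
    Filter.Eventually.of_forall fun ω => (Real.exp_pos _).le
  refine ⟨?_, ?_, ?_⟩
  · filter_upwards [hT, hmodel.ae_passageT_eq hlam hx] with ω h1 ⟨n, _, h2⟩
    rw [h1, h2]
    exact ENNReal.ofReal_lt_top
  · refine ⟨hmeas, (hasFiniteIntegral_iff_ofReal hnonneg).2 ?_⟩
    exact lt_of_eq_of_lt hlint ENNReal.ofReal_lt_top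
  · rw [mgf, integral_eq_lintegral_of_nonneg_ae hnonneg hmeas]
    refine (congrArg ENNReal.toReal hlint).trans (ENNReal.toReal_ofReal ?_)
    exact mul_nonneg (div_nonneg (by linarith) (by linarith)) (Real.exp_pos _).le
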